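/- Let $X=\{0,1\}^{\omega}$ be the Cantor space, let $\mu$ be the $(1/2,1/2)$-Bernoulli measure on $X$, and let $\mathrm{Homeo}(X)$ carry the topology with basic open sets $\{g : g(U_i)=V_i,\ i=1,\dots,n\}$, where $n\in\mathbb N$ and $U_i,V_i\subseteq X$ are clopen. For a countable group $\Gamma$ acting on $X$ by homeomorphisms, let $R_\Gamma$ be its orbit equivalence relation and let $[R_\Gamma]=\{g\in\mathrm{Homeo}(X) : \forall x\in X\ \exists\gamma\in\Gamma\ \ g(x)=\gamma\cdot x\}$ be its full group. Let $\mathbb Z$ act on $X$ by the odometer (addition of $1$ with carry to the right). Fix any bijection between $\omega$ and the free group $F_2$ on two generators, and let $F_3=F_2*\mathbb Z$ act on $X$ as follows: $F_2$ acts by the Bernoulli shift $(\gamma\cdot x)(\delta)=x(\gamma^{-1}\delta)$ on $\{0,1\}^{F_2}\cong X$, and $\mathbb Z$ acts by the odometer. Then $$\overline{[R_{\mathbb Z}]}=\overline{[R_{F_3}]}=\{g\in\mathrm{Homeo}(X) : g_*\mu=\mu\},$$ where the closures are taken in $\mathrm{Homeo}(X)$, yet $R_{\mathbb Z}$ and $R_{F_3}$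 are not orbit equivalent: there is no $g\in\mathrm{Homeo}(X)$ such that $x\,R_{\mathbb Z}\,y \Leftrightarrow g(x)\,R_{F_3}\,g(y)$ for all $x,y\in X$. -/

import Mathlib

open MeasureTheory Topology

/-! ### Homeomorphism groups, full groups, orbit equivalence

Actions of a group `Γ` by homeomorphisms on `X` are homomorphisms `Γ →* (X ≃ₜ X)`; the product
of `X ≃ₜ X` is composition. -/

section Actions

universe u v

/-- The topology on `Homeo(X)` whose basic open sets are
`{g | ∀ i ∈ {1, …, n}, g(Uᵢ) = Vᵢ}` with `Uᵢ`, `Vᵢ` clopen subsets of `X`. -/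
instance homeoTopology (X : Type u) [TopologicalSpace X] : TopologicalSpace (X ≃ₜ X) :=
  TopologicalSpace.generateFrom
    {S | ∃ U V : Set X, IsClopen U ∧ IsClopen V ∧ S = {g : X ≃ₜ X | g '' U = V}}

/-- The orbit equivalence relation `R_Γ` of an action. -/
def orbitRelation {Γ : Type v} {X : Type u} [Group Γ] [TopologicalSpace X]
    (ρ : Γ →* (X ≃ₜ X)) (x y : X) : Prop :=
  ∃ γ : Γ, ρ γ x = y

theorem orbitRelation_equivalence {Γ : Type v} {X : Type u} [Group Γ] [TopologicalSpace X]
    (ρ : Γ →* (X ≃ₜ X)) : Equivalence (orbitRelation ρ) where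
  refl x := ⟨1, by simp⟩
  symm := by
    rintro x y ⟨γ, rfl⟩
    refine ⟨γ⁻¹, ?_⟩
    change (ρ γ⁻¹ * ρ γ) x = x
    rw [← map_mul]
    simp
  trans := by
    rintro x y z ⟨γ, rfl⟩ ⟨δ, rfl⟩
    refine ⟨δ * γ, ?_⟩
    rw [map_mul]
    rfl

/-- The full group `[R_Γ] = {g ∈ Homeo(X) | ∀ x, ∃ γ ∈ Γ, g(x) = γ · x}` of an action. -/
def fullGroup {Γ : Type v} {X : Type u} [Group Γ] [TopologicalSpace X]
    (ρ : Γ →* (X ≃ₜ X)) : Subgroup (X ≃ₜ X) where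
  carrier := {g | ∀ x : X, ∃ γ : Γ, g x = ρ γ x}
  one_mem' x := ⟨1, by simp⟩
  mul_mem' := by
    intro g h hg hh x
    obtain ⟨γ, hγ⟩ := hh x
    obtain ⟨δ, hδ⟩ := hg (h x)
    refine ⟨δ * γ, ?_⟩
    rw [map_mul]
    change g (h x) = ρ δ (ρ γ x)
    rw [hδ, hγ]
  inv_mem' := by
    intro g hg x
    obtain ⟨γ, hγ⟩ := hg (g⁻¹ x)
    have hx : g (g⁻¹ x) = x := g.apply_symm_apply x
    rw [hx] at hγ
    obtain ⟨δ, hδ⟩ := (orbitRelation_equivalence ρ).symm ⟨γ, hγ.symm⟩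
    exact ⟨δ, hδ.symm⟩

/-- Two relations on `X` are orbit equivalent if a homeomorphism of `X` carries one to the
other. -/
def OrbitEquivalent {X : Type u} [TopologicalSpace X] (R S : X → X → Prop) : Prop :=
  ∃ g : X ≃ₜ X, ∀ x y : X, R x y ↔ S (g x) (g y)

end Actions

/-! ### The Cantor space `{0,1}^ω` and the Bernoulli measure -/

/-- `{0,1}^ω` with the product topology; `false` is the digit `0` and `true` the digit `1`. -/
abbrev BinSeq : Type := ℕ → Bool

/-- The `(1/2, 1/2)`-Bernoulli measure on `{0,1}^ω`. -/
noncomputable def bernoulliHalf : Measure BinSeq :=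
  Measure.infinitePi fun _ : ℕ => (PMF.uniformOfFintype Bool).toMeasure

/-! ### The odometer -/

/-- Addition of `1` with carry to the right: the `n`-th digit is flipped exactly when all earlier
digits are `1`. -/
def odometerFun (x : BinSeq) : BinSeq := fun n => xor (x n) (decide (∀ m < n, x m = true))

/-- Subtraction of `1` with borrowing: the `n`-th digit is flipped exactly when all earlier digits
are `0`. -/
def odometerInvFun (x : BinSeq) : BinSeq := fun n => xor (x n) (decide (∀ m < n, x m = false))

theorem odometerFun_all_false_iff (x : BinSeq) (n : ℕ) :
    (∀ m < n, odometerFun x m = false) ↔ ∀ m < n, x m = true := by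
  induction n with
  | zero => simp
  | succ n ih =>
    simp only [Nat.lt_succ_iff_lt_or_eq, or_imp, forall_and, forall_eq, ih]
    refine and_congr_right fun h => ?_
    simp only [odometerFun, decide_eq_true h]
    cases x n <;> simp

theorem odometerInvFun_all_true_iff (x : BinSeq) (n : ℕ) :
    (∀ m < n, odometerInvFun x m = true) ↔ ∀ m < n, x m = false := by
  induction n with
  | zero => simp
  | succ n ih =>
    simp only [Nat.lt_succ_iff_lt_or_eq, or_imp, forall_and, forall_eq, ih]
    refine and_congr_right fun h => ?_
    simp only [odometerInvFun, decide_eq_true h]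
    cases x n <;> simp

theorem continuous_of_initial_segment (F : BinSeq → BinSeq)
    (hF : ∀ n x y, (∀ m ≤ n, x m = y m) → F x n = F y n) : Continuous F := by
  refine continuous_pi fun n => ?_
  have : (fun x => F x n) = (fun z : Fin (n + 1) → Bool =>
      F (fun m => if h : m < n + 1 then z ⟨m, h⟩ else false) n) ∘
      fun (x : BinSeq) (i : Fin (n + 1)) => x i := by
    funext x
    refine hF n _ _ fun m hm => ?_
    simp [Nat.lt_succ_of_le hm]
  rw [this]
  exact continuous_of_discreteTopology.comp (continuous_pi fun i => continuous_apply _)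

/-- The odometer, as a homeomorphism of `{0,1}^ω`. -/
def odometer : BinSeq ≃ₜ BinSeq where
  toFun := odometerFun
  invFun := odometerInvFun
  left_inv x := by
    funext n
    change xor (odometerFun x n) (decide (∀ m < n, odometerFun x m = false)) = x n
    simp only [odometerFun_all_false_iff]
    simp [odometerFun]
  right_inv x := by
    funext n
    change xor (odometerInvFun x n) (decide (∀ m < n, odometerInvFun x m = true)) = x n
    simp only [odometerInvFun_all_true_iff]
    simp [odometerInvFun]
  continuous_toFun := by
    refine continuous_of_initial_segment _ fun n x y h => ?_
    have : (∀ m < n, x m = true) ↔ ∀ m < n, y m = true :=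
      forall₂_congr fun m hm => by rw [h m hm.le]
    simp only [odometerFun, h n le_rfl, this]
  continuous_invFun := by
    refine continuous_of_initial_segment _ fun n x y h => ?_
    have : (∀ m < n, x m = false) ↔ ∀ m < n, y m = false :=
      forall₂_congr fun m hm => by rw [h m hm.le]
    simp only [odometerInvFun, h n le_rfl, this]

/-- The action of `ℤ` on `{0,1}^ω` generated by the odometer. -/
def odometerAction : Multiplicative ℤ →* (BinSeq ≃ₜ BinSeq) :=
  zpowersHom (BinSeq ≃ₜ BinSeq) odometer

/-! ### The Bernoulli shift of `F₂` and the action of `F₃` -/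

/-- The Bernoulli shift of `F₂` on `{0,1}^{F₂}`, `(γ · x)(δ) = x(γ⁻¹ δ)`, transported to
`{0,1}^ω` along a bijection `e` between `ω` and `F₂`. -/
def bernoulliShift (e : ℕ ≃ FreeGroup (Fin 2)) : FreeGroup (Fin 2) →* (BinSeq ≃ₜ BinSeq) where
  toFun γ :=
    { toFun := fun x n => x (e.symm (γ⁻¹ * e n))
      invFun := fun x n => x (e.symm (γ * e n))
      left_inv := fun x => by funext n; simp
      right_inv := fun x => by funext n; simp
      continuous_toFun := continuous_pi fun n => continuous_apply _
      continuous_invFun := continuous_pi fun n => continuous_apply _ }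
  map_one' := by
    ext x n
    change x (e.symm (1⁻¹ * e n)) = x n
    simp
  map_mul' γ δ := by
    ext x n
    change x (e.symm ((γ * δ)⁻¹ * e n)) = x (e.symm (δ⁻¹ * e (e.symm (γ⁻¹ * e n))))
    simp [mul_assoc]

/-- The action of `F₃ = F₂ * ℤ` on `{0,1}^ω`: the first two generators act by the Bernoulli shift
of `F₂`, the third one acts by the odometer. -/
def freeThreeAction (e : ℕ ≃ FreeGroup (Fin 2)) : FreeGroup (Fin 3) →* (BinSeq ≃ₜ BinSeq) :=
  FreeGroup.lift ![bernoulliShift e (FreeGroup.of 0), bernoulliShift e (FreeGroup.of 1), odometer]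

theorem freeThreeAction_freeTwo (e : ℕ ≃ FreeGroup (Fin 2)) (γ : FreeGroup (Fin 2)) :
    freeThreeAction e (FreeGroup.map Fin.castSucc γ) = bernoulliShift e γ := by
  have : (freeThreeAction e).comp (FreeGroup.map Fin.castSucc) = bernoulliShift e := by
    refine FreeGroup.ext_hom _ _ fun i => ?_
    fin_cases i <;> simp [freeThreeAction]
  exact DFunLike.congr_fun this γ

theorem freeThreeAction_int (e : ℕ ≃ FreeGroup (Fin 2)) (k : ℤ) :
    freeThreeAction e (FreeGroup.of 2 ^ k) = odometerAction (Multiplicative.ofAdd k) := by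
  simp [freeThreeAction, odometerAction]

/-- Bijections between `ω` and `F₂` exist. -/
theorem nonempty_equiv_freeTwo : Nonempty (ℕ ≃ FreeGroup (Fin 2)) := by
  have : Countable (FreeGroup (Fin 2)) := Quot.mk_surjective.countable
  have : Infinite (FreeGroup (Fin 2)) := inferInstance
  exact nonempty_equiv_of_countable

/-! Closures. An element of either full group agrees piecewise with measure-preserving
homeomorphisms, so it preserves $\mu$ (`fullGroup_le_measurePreservingHomeo`); this passes to the
closure because cylinders determine $\mu$. Conversely, let $g$ preserve $\mu$ and let finitely many
clopen $U_i$ be given. For large $n$, all $U_i$ and $g(U_i)$ are unions of cylinders of length $n$.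
Corresponding cells of the two partitions have equal measure, hence contain equally many words of
length $n$, so some permutation of words sends each $U_i$ to $g(U_i)$. It changes only the first $n$
digits and therefore lies in the full group of the odometer (`exists_mem_fullGroup_image_eq`), which
is contained in that of $F_3$.

Inequivalence. Off one countable orbit, the odometer relation is contained in the increasing union
of the finite relations `agreeFrom n`. An orbit equivalence would carry these to finite relations
exhausting almost every orbit of the Bernoulli shift of $F_2$, which is essentially free and
preserves $\mu$. Averaging uniform measures on the finite classes then yields almost invariant
probability measures on $F_2$, which its paradoxical decomposition forbids
(`FreeGroup.not_hyperfinite`). -/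

/-! ### Free actions of $F_2$ and finite equivalence relations -/

open ProbabilityTheory in
/-- A free measure-preserving action of a countable group, together with an equivalence relation
with finite classes, yields a probability measure on the group which is left invariant up to the
measure of the set of points that the group element moves out of their class. -/
theorem exists_almost_invariant_measure {G X : Type*} [Group G] [Countable G] [MeasurableSpace G]
    [DiscreteMeasurableSpace G] [MeasurableSpace X] [MulAction G X] [MeasurableConstSMul G X]
    (μ : Measure X) [IsProbabilityMeasure μ] [SMulInvariantMeasure G X μ]
    (hfree : ∀ γ : G, γ ≠ 1 → ∀ᵐ x ∂μ, γ • x ≠ x) (E : Setoid X)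
    (hmeas : ∀ γ : G, MeasurableSet {x : X | E (γ • x) x}) (hfin : ∀ x, {y | E y x}.Finite) :
    ∃ ν : Measure G, IsProbabilityMeasure ν ∧
      ∀ (γ : G) (A : Set G), ν ((γ * ·) ⁻¹' A) ≤ ν A + μ {x | ¬ E (γ • x) x} := by
  -- The inverse makes $C$ equivariant: $C(\gamma x) = \gamma\, C(x)$ whenever $\gamma x$ and $x$
  -- are equivalent.
  set C : X → Set G := fun x => {δ | E (δ⁻¹ • x) x} with hC
  have hcount : ∀ A : Set G, Measurable fun x => (Measure.count (C x ∩ A)) := by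
    intro A
    have : (fun x => (Measure.count (C x ∩ A))) =
        fun x => ∑' δ : G, ({x | E (δ⁻¹ • x) x} ∩ {_x | δ ∈ A}).indicator 1 x := by
      funext x
      rw [← lintegral_indicator_one (.of_discrete), lintegral_count]
      rfl
    rw [this]
    exact Measurable.tsum fun δ =>
      measurable_one.indicator ((hmeas _).inter (.const _))
  have hker : Measurable fun x => uniformOn (C x) := by
    refine Measure.measurable_of_measurable_coe _ fun A _ => ?_
    simp only [uniformOn, cond_apply MeasurableSet.of_discrete]
    refine Measurable.mul ?_ (hcount A)
    have h := hcount Set.univ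
    simp only [Set.inter_univ] at h
    exact h.inv
  have hCfin : ∀ᵐ x ∂μ, (C x).Finite := by
    have : ∀ᵐ x ∂μ, ∀ γ : G, γ ≠ 1 → γ • x ≠ x := by
      rw [ae_all_iff]
      intro γ
      by_cases h : γ = 1
      · simp [h]
      · simpa only [ne_eq, h, not_false_eq_true, forall_const] using hfree γ h
    filter_upwards [this] with x hx
    refine Set.Finite.of_finite_image (f := fun δ : G => δ⁻¹ • x)
      ((hfin x).subset (Set.image_subset_iff.2 fun δ hδ => hδ)) ?_
    intro a _ b _ hab
    by_contra hne
    refine hx (b * a⁻¹) (fun h => hne (mul_inv_eq_one.1 h).symm) ?_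
    simp only at hab
    rw [mul_smul, hab, smul_inv_smul]
  have hone : ∀ x, (1 : G) ∈ C x := fun x => by
    simp [hC]
  have hbind : ∀ A : Set G, μ.bind (fun x => uniformOn (C x)) A = ∫⁻ x, uniformOn (C x) A ∂μ :=
    fun A => Measure.bind_apply .of_discrete hker.aemeasurable
  have hmA : ∀ A : Set G, Measurable fun x => uniformOn (C x) A := fun A =>
    (Measure.measurable_coe .of_discrete).comp hker
  -- $\nu$ is the $\mu$-average of the uniform measures on the sets $C(x)$, which are almost surely
  -- finite by freeness.
  refine ⟨μ.bind fun x => uniformOn (C x), ⟨?_⟩, fun γ A => ?_⟩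
  · rw [hbind]
    have : ∀ᵐ x ∂μ, uniformOn (C x) Set.univ = 1 := by
      filter_upwards [hCfin] with x hx
      exact uniformOn_of_univ hx ⟨1, hone x⟩
    rw [lintegral_congr_ae this]
    simp
  -- Invariance of $\mu$ replaces $x$ by $\gamma x$ in the integral for $\nu(A)$. The integrands can
  -- then be compared pointwise: they agree where $\gamma x$ is equivalent to $x$, and elsewhere the
  -- error term contributes 1.
  · rw [hbind, hbind, ← (measurePreserving_smul γ μ).lintegral_comp (hmA A),
      show {x | ¬ E (γ • x) x} = {x | E (γ • x) x}ᶜ from rfl,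
      ← lintegral_indicator_one (hmeas γ).compl, ← lintegral_add_left (show
        Measurable fun x => uniformOn (C (γ • x)) A from (hmA A).comp (measurable_const_smul γ))]
    refine lintegral_mono fun x => ?_
    by_cases hx : E (γ • x) x
    · refine le_add_right (le_of_eq ?_)
      have hCγ : C (γ • x) = (γ * ·) '' C x := by
        ext δ
        rw [Set.image_mul_left]
        simp only [hC, Set.mem_ofPred_eq, Set.mem_preimage, mul_inv_rev, inv_inv, mul_smul]
        exact ⟨fun h => E.trans h hx, fun h => E.trans h (E.symm hx)⟩
      have hinj : ∀ s : Set G, Measure.count ((γ * ·) '' s) = Measure.count s := fun s =>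
        Measure.count_injective_image (mul_right_injective γ) s
      rw [hCγ, uniformOn, uniformOn, cond_apply .of_discrete, cond_apply .of_discrete, hinj,
        ← Set.image_inter_preimage, hinj]
    · have hp : uniformOn (C x) ((γ * ·) ⁻¹' A) ≤ 1 := prob_le_one
      refine hp.trans (le_add_left ?_)
      have : x ∈ {x | E (γ • x) x}ᶜ := hx
      rw [Set.indicator_of_mem this]
      rfl

open FreeGroup in
/-- A probability measure on a free group of rank two is far from left invariant. -/
theorem FreeGroup.two_le_of_almost_invariant [MeasurableSpace (FreeGroup (Fin 2))]
    [DiscreteMeasurableSpace (FreeGroup (Fin 2))] (ν : Measure (FreeGroup (Fin 2)))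
    [IsProbabilityMeasure ν] (ε : Fin 2 → ENNReal)
    (h : ∀ (i : Fin 2) (A : Set (FreeGroup (Fin 2))), ν ((of i * ·) ⁻¹' A) ≤ ν A + ε i) :
    1 ≤ ε 0 + ε 1 := by
  -- If $g$ does not start with $a_i^{-1}$, then $a_i g$ starts with $a_i$. So the words starting
  -- with $a_i^{\pm1}$ have mass at least $1 - \varepsilon_i$; for $i = 0, 1$ these sets are
  -- disjoint.
  have key : ∀ i : Fin 2, 1 ≤ ν (startsWith (i, true) ∪ startsWith (i, false)) + ε i := by
    intro i
    have hcov : (Set.univ : Set (FreeGroup (Fin 2))) ⊆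
        startsWith (i, false) ∪ (of i * ·) ⁻¹' startsWith (i, true) := fun g _ => by
      by_cases hg : g ∈ startsWith (i, false)
      · exact .inl hg
      · exact .inr (startsWith_mk_mul (w := (i, true)) g hg)
    calc (1 : ENNReal) = ν Set.univ := measure_univ.symm
      _ ≤ ν (startsWith (i, false)) + ν ((of i * ·) ⁻¹' startsWith (i, true)) :=
        (measure_mono hcov).trans (measure_union_le _ _)
      _ ≤ ν (startsWith (i, false)) + (ν (startsWith (i, true)) + ε i) := by
        gcongr
        exact h i _
      _ = _ := by
        rw [measure_union (by simp) .of_discrete]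
        ring
  have hdisj : Disjoint (startsWith ((0 : Fin 2), true) ∪ startsWith (0, false))
      (startsWith (1, true) ∪ startsWith (1, false)) := by
    simp [Set.disjoint_union_left, Set.disjoint_union_right]
  have hle := prob_le_one (μ := ν) (s := (startsWith ((0 : Fin 2), true) ∪ startsWith (0, false)) ∪
    (startsWith (1, true) ∪ startsWith (1, false)))
  rw [measure_union hdisj .of_discrete] at hle
  have h2 := add_le_add (key 0) (key 1)
  refine ENNReal.le_of_add_le_add_left (a := 1) (by simp) (h2.trans ?_)
  calc _ = _ := add_add_add_comm _ _ _ _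
    _ ≤ _ := by gcongr

/-- The orbits of a free measure-preserving action of a free group of rank two are not contained,
almost everywhere, in an increasing union of equivalence relations with finite classes. -/
theorem FreeGroup.not_hyperfinite {X : Type*} [MeasurableSpace X] [MulAction (FreeGroup (Fin 2)) X]
    [MeasurableConstSMul (FreeGroup (Fin 2)) X] (μ : Measure X) [IsProbabilityMeasure μ]
    [SMulInvariantMeasure (FreeGroup (Fin 2)) X μ]
    (hfree : ∀ γ : FreeGroup (Fin 2), γ ≠ 1 → ∀ᵐ x ∂μ, γ • x ≠ x) (E : ℕ → Setoid X)
    (hmono : Monotone E)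
    (hmeas : ∀ n, ∀ γ : FreeGroup (Fin 2), MeasurableSet {x : X | E n (γ • x) x})
    (hfin : ∀ n x, {y | E n y x}.Finite)
    (hex : ∀ γ : FreeGroup (Fin 2), ∀ᵐ x ∂μ, ∃ n, E n (γ • x) x) : False := by
  let _ : MeasurableSpace (FreeGroup (Fin 2)) := ⊤
  have : Countable (FreeGroup (Fin 2)) := Quot.mk_surjective.countable
  have htend : ∀ γ : FreeGroup (Fin 2),
      Filter.Tendsto (fun n => μ {x | ¬ E n (γ • x) x}) Filter.atTop (𝓝 0) := by
    intro γ
    have h0 : μ (⋂ n, {x | ¬ E n (γ • x) x}) = 0 := by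
      have := hex γ
      rw [ae_iff] at this
      convert! this using 2
      ext x
      simp
    rw [← h0]
    refine tendsto_measure_iInter_atTop (fun n => (hmeas n γ).compl.nullMeasurableSet) ?_
      ⟨0, measure_ne_top _ _⟩
    exact fun m n hmn x hx h => hx (hmono hmn h)
  have hsum := (htend (FreeGroup.of 0)).add (htend (FreeGroup.of 1))
  rw [add_zero] at hsum
  obtain ⟨n, hn⟩ := (hsum.eventually (gt_mem_nhds one_pos)).exists
  obtain ⟨ν, hν, hinv⟩ := exists_almost_invariant_measure μ hfree (E n) (hmeas n) (hfin n)
  exact hn.not_ge (FreeGroup.two_le_of_almost_invariant ν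
    (fun i => μ {x | ¬ E n (FreeGroup.of i • x) x}) fun i A => hinv _ A)

/-! ### Measure-preserving homeomorphisms and full groups -/

/-- The homeomorphisms of `X` that preserve the measure `μ`. -/
def measurePreservingHomeo {X : Type*} [TopologicalSpace X] [MeasurableSpace X] [BorelSpace X]
    (μ : Measure X) : Subgroup (X ≃ₜ X) where
  carrier := {g | MeasurePreserving g μ μ}
  one_mem' := MeasurePreserving.id μ
  mul_mem' {g h} (hg : MeasurePreserving g μ μ) (hh : MeasurePreserving h μ μ) := hg.comp hh
  inv_mem' {g} (hg : MeasurePreserving g.toMeasurableEquiv μ μ) :=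
    MeasurePreserving.symm g.toMeasurableEquiv hg

theorem mem_measurePreservingHomeo {X : Type*} [TopologicalSpace X] [MeasurableSpace X]
    [BorelSpace X] {μ : Measure X} {g : X ≃ₜ X} :
    g ∈ measurePreservingHomeo μ ↔ MeasurePreserving g μ μ := Iff.rfl

theorem measure_image_of_mem_measurePreservingHomeo {X : Type*} [TopologicalSpace X]
    [MeasurableSpace X] [BorelSpace X] {μ : Measure X} {g : X ≃ₜ X}
    (hg : g ∈ measurePreservingHomeo μ) (s : Set X) : μ (g '' s) = μ s := by
  have hg' : MeasurePreserving g.toMeasurableEquiv μ μ := hg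
  rw [← hg'.measure_preimage_equiv (g '' s)]
  congr 1
  exact g.injective.preimage_image s

/-- The full group of a measure-preserving action of a countable group preserves the measure. -/
theorem fullGroup_le_measurePreservingHomeo {Γ X : Type*} [Group Γ] [Countable Γ]
    [TopologicalSpace X] [T2Space X] [MeasurableSpace X] [BorelSpace X] (μ : Measure X)
    (ρ : Γ →* (X ≃ₜ X)) (hρ : ∀ γ, ρ γ ∈ measurePreservingHomeo μ) :
    fullGroup ρ ≤ measurePreservingHomeo μ := by
  -- One inequality suffices, since it can be applied to both $g$ and $g^{-1}$.
  have hle : ∀ g ∈ fullGroup ρ, ∀ A, MeasurableSet A → μ (g '' A) ≤ μ A := by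
    intro g hg A hA
    obtain ⟨u, hu⟩ := exists_surjective_nat Γ
    set P : ℕ → Set X := disjointed fun n => {x | g x = ρ (u n) x} with hP
    have hPm : ∀ n, MeasurableSet (P n) := MeasurableSet.disjointed fun n =>
      (isClosed_eq g.continuous (ρ (u n)).continuous).measurableSet
    have hPu : ⋃ n, P n = Set.univ := by
      rw [hP, iUnion_disjointed, Set.eq_univ_iff_forall]
      intro x
      obtain ⟨γ, hγ⟩ := hg x
      obtain ⟨n, rfl⟩ := hu γ
      exact Set.mem_iUnion.2 ⟨n, hγ⟩
    have hA' : A = ⋃ n, A ∩ P n := by rw [← Set.inter_iUnion, hPu, Set.inter_univ]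
    calc μ (g '' A) = μ (⋃ n, g '' (A ∩ P n)) := by rw [← Set.image_iUnion, ← hA']
      _ ≤ ∑' n, μ (g '' (A ∩ P n)) := measure_iUnion_le _
      _ = ∑' n, μ (A ∩ P n) := by
        refine tsum_congr fun n => ?_
        rw [← measure_image_of_mem_measurePreservingHomeo (hρ (u n)) (A ∩ P n)]
        congr 1
        exact Set.image_congr fun x hx => disjointed_subset _ n hx.2
      _ = μ A := by
        conv_rhs => rw [hA']
        refine (measure_iUnion ?_ fun n => hA.inter (hPm n)).symm
        exact fun i j hij => (disjoint_disjointed _ hij).mono Set.inter_subset_right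
          Set.inter_subset_right
  intro g hg
  rw [mem_measurePreservingHomeo]
  refine ⟨g.continuous.measurable, Measure.ext fun A hA => ?_⟩
  rw [Measure.map_apply g.continuous.measurable hA]
  refine le_antisymm ?_ ?_
  · have h := hle g⁻¹ (inv_mem hg) A hA
    rwa [show (⇑g⁻¹ '' A) = g ⁻¹' A from g.symm.image_eq_preimage_symm A] at h
  · have h := hle g hg (g ⁻¹' A) (g.continuous.measurable hA)
    rwa [Set.image_preimage_eq _ g.surjective] at h

/-! ### The Bernoulli measure -/

instance : IsProbabilityMeasure bernoulliHalf := by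
  unfold bernoulliHalf
  infer_instance

theorem bernoulliHalf_pi_singleton (s : Finset ℕ) (x : BinSeq) :
    bernoulliHalf {y | ∀ i ∈ s, y i = x i} = 2⁻¹ ^ s.card := by
  have h : {y : BinSeq | ∀ i ∈ s, y i = x i} = (s : Set ℕ).pi fun i => {x i} := by
    ext y
    simp [Set.mem_pi]
  rw [h, bernoulliHalf, Measure.infinitePi_pi _ fun i _ => measurableSet_singleton _]
  simp

theorem bernoulliHalf_cylinder (x : BinSeq) (n : ℕ) :
    bernoulliHalf (PiNat.cylinder x n) = 2⁻¹ ^ n := by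
  have h := bernoulliHalf_pi_singleton (Finset.range n) x
  simp only [Finset.mem_range, Finset.card_range] at h
  exact h

/-- Any $n$ of the prescribed coordinates already bound the measure by $2^{-n}$. -/
theorem bernoulliHalf_eqOn_infinite {s : Set ℕ} (hs : s.Infinite) (x : BinSeq) :
    bernoulliHalf {y | ∀ i ∈ s, y i = x i} = 0 := by
  refine le_antisymm (ge_of_tendsto' (ENNReal.tendsto_pow_atTop_nhds_zero_of_lt_one
    (r := 2⁻¹) (by simp)) fun n => ?_) zero_le
  obtain ⟨t, hts, rfl⟩ := hs.exists_subset_card_eq n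
  rw [← bernoulliHalf_pi_singleton t x]
  exact measure_mono fun y hy i hi => hy i (hts hi)

instance : NullSingletonClass bernoulliHalf where
  measure_singleton x := by
    rw [← bernoulliHalf_eqOn_infinite Set.infinite_univ x]
    congr 1
    ext y
    simp [funext_iff]

theorem isPiSystem_cylinder_binSeq :
    IsPiSystem {s : Set BinSeq | ∃ (x : BinSeq) (n : ℕ), s = PiNat.cylinder x n} := by
  rintro _ ⟨x, m, rfl⟩ _ ⟨y, n, rfl⟩ ⟨z, hzx, hzy⟩
  refine ⟨z, max m n, ?_⟩
  rw [← PiNat.mem_cylinder_iff_eq.1 hzx, ← PiNat.mem_cylinder_iff_eq.1 hzy]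
  ext w
  simp only [Set.mem_inter_iff, PiNat.mem_cylinder_iff, lt_max_iff, or_imp, forall_and]

theorem measure_binSeq_ext {ν ν' : Measure BinSeq} [IsFiniteMeasure ν]
    (h : ∀ x n, ν (PiNat.cylinder x n) = ν' (PiNat.cylinder x n)) : ν = ν' := by
  refine ext_of_generate_finite _ ?_ isPiSystem_cylinder_binSeq ?_ ?_
  · rw [BorelSpace.measurable_eq (α := BinSeq)]
    exact (PiNat.isTopologicalBasis_cylinders fun _ : ℕ => Bool).borel_eq_generateFrom
  · rintro _ ⟨x, n, rfl⟩
    exact h x n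
  · simpa using h (fun _ => false) 0

theorem isClopen_cylinder_binSeq (x : BinSeq) (n : ℕ) : IsClopen (PiNat.cylinder x n) := by
  rw [PiNat.cylinder_eq_pi]
  exact ⟨isClosed_set_pi fun _ _ => isClosed_discrete _,
    isOpen_set_pi (Finset.range n).finite_toSet fun _ _ => isOpen_discrete _⟩

/-- A homeomorphism that is approximated by measure-preserving ones preserves the measure. -/
theorem closure_subset_measurePreservingHomeo {S : Set (BinSeq ≃ₜ BinSeq)}
    (hS : S ⊆ measurePreservingHomeo bernoulliHalf) :
    closure S ⊆ measurePreservingHomeo bernoulliHalf := by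
  intro g hg
  -- Passing to $g^{-1}$ turns preimages into the images $g(U)$, which are what the topology
  -- controls.
  refine inv_mem_iff.1 (mem_measurePreservingHomeo.2 ⟨g.symm.continuous.measurable, ?_⟩)
  have : IsProbabilityMeasure (bernoulliHalf.map g.symm) :=
    Measure.isProbabilityMeasure_map g.symm.continuous.measurable.aemeasurable
  refine measure_binSeq_ext (ν := bernoulliHalf.map g.symm) fun x n => ?_
  have hU := isClopen_cylinder_binSeq x n
  have hopen : IsOpen {h : BinSeq ≃ₜ BinSeq | h '' PiNat.cylinder x n = g '' PiNat.cylinder x n} :=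
    TopologicalSpace.isOpen_generateFrom_of_mem
      ⟨_, _, hU, by rw [g.image_eq_preimage_symm]; exact hU.preimage g.symm.continuous, rfl⟩
  obtain ⟨h, hh, hhS⟩ := mem_closure_iff.1 hg _ hopen rfl
  rw [Measure.map_apply g.symm.continuous.measurable hU.isClosed.measurableSet, ← g.image_eq_preimage_symm,
    ← (hh : h '' _ = _), measure_image_of_mem_measurePreservingHomeo (hS hhS)]

/-! ### The odometer and tail equivalence -/

/-- The relation "`x` and `y` agree from the `n`-th digit on". -/
def agreeFrom (n : ℕ) : Setoid BinSeq where
  r x y := ∀ i ≥ n, x i = y i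
  iseqv := ⟨fun _ _ _ => rfl, fun h i hi => (h i hi).symm, fun h h' i hi =>
    (h i hi).trans (h' i hi)⟩

theorem agreeFrom_mono : Monotone agreeFrom := fun _ _ hmn _ _ h i hi => h i (hmn.trans hi)

theorem agreeFrom_finite (n : ℕ) (x : BinSeq) : {y | agreeFrom n y x}.Finite := by
  refine Set.Finite.of_finite_image (f := fun (y : BinSeq) (i : Fin n) => y i)
    (Set.toFinite _) fun y hy z hz h => funext fun i => ?_
  by_cases hi : i < n
  · exact congrFun h ⟨i, hi⟩
  · exact (hy i (not_lt.1 hi)).trans (hz i (not_lt.1 hi)).symm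

theorem odometerAction_ofAdd_add_one (k : ℤ) (x : BinSeq) :
    odometerAction (.ofAdd (k + 1)) x = odometer (odometerAction (.ofAdd k) x) := by
  have : odometerAction (.ofAdd (k + 1)) = odometer * odometerAction (.ofAdd k) := by
    rw [add_comm, ofAdd_add, map_mul]
    simp [odometerAction]
  rw [this]
  rfl

theorem orbitRelation_odometer (x : BinSeq) : orbitRelation odometerAction x (odometer x) :=
  ⟨.ofAdd 1, by simp [odometerAction]⟩

/-- Clearing an initial segment gives a normal form: sequences that agree from the $n$-th digit on
become equal. -/
theorem orbitRelation_odometer_clear (n : ℕ) (x : BinSeq) :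
    orbitRelation odometerAction x (fun i => if i < n then false else x i) := by
  have E := orbitRelation_equivalence odometerAction
  induction n generalizing x with
  | zero => simpa using E.refl x
  | succ n ih =>
    have key : ∀ y : BinSeq, y n = false → (∀ i > n, y i = x i) →
        orbitRelation odometerAction y (fun i => if i < n + 1 then false else x i) := by
      intro y hyn hy
      convert! ih y using 1
      funext i
      rcases lt_trichotomy i n with h | rfl | h
      · simp [h, h.trans (Nat.lt_succ_self n)]
      · simp [hyn]
      · simp [h.not_gt, show ¬ i < n + 1 by lia, hy i h]
    by_cases hx : x n = false
    · exact key x hx fun _ _ => rfl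
    -- Here $y$ is $0^n1\cdots$; subtracting 1 gives $1^n0\cdots$ with the same tail. This clears
    -- digit $n$, and the induction hypothesis clears the digits below it again.
    · set y : BinSeq := fun i => if i < n then false else x i with hy
      have hyz : orbitRelation odometerAction (odometer.symm y) y := by
        simpa using orbitRelation_odometer (odometer.symm y)
      have hval : ∀ i, odometer.symm y i = xor (y i) (decide (∀ m < i, y m = false)) := fun _ => rfl
      refine E.trans (ih x) (E.trans (E.symm hyz) (key _ ?_ fun i hi => ?_))
      · have hyn : y n = true := by simpa [hy] using hx
        have hlt : ∀ m < n, y m = false := fun m hm => by simp [hy, hm]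
        rw [hval, hyn, decide_eq_true hlt]
        rfl
      · have : ¬ ∀ m < i, y m = false := fun h => hx (by simpa [hy] using h n hi)
        rw [hval, decide_eq_false this]
        simp [hy, not_lt.2 hi.le]

theorem orbitRelation_odometer_of_agreeFrom {n : ℕ} {x y : BinSeq} (h : agreeFrom n x y) :
    orbitRelation odometerAction x y := by
  have E := orbitRelation_equivalence odometerAction
  refine E.trans (orbitRelation_odometer_clear n x) ?_
  convert! E.symm (orbitRelation_odometer_clear n y) using 1
  funext i
  split_ifs with hi
  · rfl
  · exact h i (not_lt.1 hi)

/-- The carry stops at the first digit 0. -/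
theorem exists_agreeFrom_odometer {x : BinSeq} (hx : x ≠ fun _ => true) :
    ∃ n, agreeFrom n (odometer x) x := by
  obtain ⟨m, hm⟩ := Function.ne_iff.1 hx
  refine ⟨m + 1, fun i hi => ?_⟩
  have : ¬ ∀ j < i, x j = true := fun h => hm (h m hi)
  change xor (x i) (decide (∀ j < i, x j = true)) = x i
  rw [decide_eq_false this, Bool.xor_false]

/-- Only at the all-ones point does the carry run forever. An orbit avoiding that point changes
finitely many digits at each step, forwards or backwards. -/
theorem exists_agreeFrom_odometerAction {x : BinSeq}
    (hx : ¬ orbitRelation odometerAction (fun _ => true) x) {y : BinSeq}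
    (hxy : orbitRelation odometerAction x y) : ∃ n, agreeFrom n y x := by
  have step : ∀ k : ℤ, ∃ n, agreeFrom n (odometerAction (.ofAdd (k + 1)) x)
      (odometerAction (.ofAdd k) x) := by
    intro k
    rw [odometerAction_ofAdd_add_one]
    refine exists_agreeFrom_odometer fun h => hx ?_
    exact (orbitRelation_equivalence odometerAction).symm ⟨_, h⟩
  have main : ∀ k : ℤ, ∃ n, agreeFrom n (odometerAction (.ofAdd k) x) x := by
    intro k
    induction k using Int.induction_on with
    | zero => exact ⟨0, by simp [Setoid.refl]⟩
    | succ k ih =>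
      obtain ⟨a, ha⟩ := ih
      obtain ⟨b, hb⟩ := step k
      exact ⟨max a b, (agreeFrom _).trans (agreeFrom_mono (le_max_right a b) hb)
        (agreeFrom_mono (le_max_left a b) ha)⟩
    | pred k ih =>
      obtain ⟨a, ha⟩ := ih
      obtain ⟨b, hb⟩ := step (-k - 1)
      rw [sub_add_cancel] at hb
      exact ⟨max a b, (agreeFrom _).trans ((agreeFrom _).symm
        (agreeFrom_mono (le_max_right a b) hb)) (agreeFrom_mono (le_max_left a b) ha)⟩
  obtain ⟨k, rfl⟩ := hxy
  exact main k.toAdd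

theorem odometer_preimage_cylinder (x : BinSeq) (n : ℕ) :
    odometer ⁻¹' PiNat.cylinder x n = PiNat.cylinder (odometer.symm x) n := by
  have hfwd : ∀ y z : BinSeq, (∀ i < n, y i = z i) → ∀ i < n, odometer y i = odometer z i := by
    intro y z h i hi
    have : (∀ m < i, y m = true) ↔ ∀ m < i, z m = true :=
      forall₂_congr fun m hm => by rw [h m (hm.trans hi)]
    change xor (y i) (decide _) = xor (z i) (decide _)
    rw [h i hi]
    simp only [this]
  have hbwd : ∀ y z : BinSeq, (∀ i < n, y i = z i) →
      ∀ i < n, odometer.symm y i = odometer.symm z i := by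
    intro y z h i hi
    have : (∀ m < i, y m = false) ↔ ∀ m < i, z m = false :=
      forall₂_congr fun m hm => by rw [h m (hm.trans hi)]
    change xor (y i) (decide _) = xor (z i) (decide _)
    rw [h i hi]
    simp only [this]
  ext y
  simp only [Set.mem_preimage, PiNat.mem_cylinder_iff]
  constructor
  · intro h
    simpa using hbwd _ _ h
  · intro h
    simpa using hfwd _ _ h

theorem odometer_mem_measurePreservingHomeo :
    odometer ∈ measurePreservingHomeo bernoulliHalf := by
  rw [mem_measurePreservingHomeo]
  refine ⟨odometer.continuous.measurable, ?_⟩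
  have : IsProbabilityMeasure (bernoulliHalf.map odometer) :=
    Measure.isProbabilityMeasure_map odometer.continuous.measurable.aemeasurable
  refine measure_binSeq_ext (ν := bernoulliHalf.map odometer) fun x n => ?_
  rw [Measure.map_apply odometer.continuous.measurable
    (isClopen_cylinder_binSeq x n).isClosed.measurableSet, odometer_preimage_cylinder,
    bernoulliHalf_cylinder, bernoulliHalf_cylinder]

theorem odometerAction_mem_measurePreservingHomeo (k : Multiplicative ℤ) :
    odometerAction k ∈ measurePreservingHomeo bernoulliHalf := by
  rw [odometerAction, zpowersHom_apply]
  exact zpow_mem odometer_mem_measurePreservingHomeo _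

/-! ### The Bernoulli shift -/

theorem bernoulliShift_mem_measurePreservingHomeo (e : ℕ ≃ FreeGroup (Fin 2))
    (γ : FreeGroup (Fin 2)) : bernoulliShift e γ ∈ measurePreservingHomeo bernoulliHalf := by
  rw [mem_measurePreservingHomeo]
  refine ⟨(bernoulliShift e γ).continuous.measurable, ?_⟩
  -- The shift permutes coordinates, and all factors of the product measure are equal.
  set σ : ℕ ≃ ℕ := (e.trans (Equiv.mulLeft γ)).trans e.symm with hσ
  have h := Measure.infinitePi_map_piCongrLeft (X := fun _ : ℕ => Bool)
    (fun _ : ℕ => (PMF.uniformOfFintype Bool).toMeasure) σ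
  rw [← bernoulliHalf] at h
  convert! h using 2
  funext x n
  obtain ⟨m, rfl⟩ := σ.surjective n
  have : MeasurableEquiv.piCongrLeft (fun _ : ℕ => Bool) σ x (σ m) = x m :=
    Equiv.piCongrLeft_apply_apply (P := fun _ : ℕ => Bool) σ x m
  rw [this]
  change x (e.symm (γ⁻¹ * e (σ m))) = x m
  simp [hσ]

theorem freeThreeAction_mem_measurePreservingHomeo (e : ℕ ≃ FreeGroup (Fin 2))
    (γ : FreeGroup (Fin 3)) : freeThreeAction e γ ∈ measurePreservingHomeo bernoulliHalf := by
  refine FreeGroup.range_lift_le ?_ ⟨γ, rfl⟩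
  rintro _ ⟨i, rfl⟩
  fin_cases i
  · exact bernoulliShift_mem_measurePreservingHomeo e _
  · exact bernoulliShift_mem_measurePreservingHomeo e _
  · exact odometer_mem_measurePreservingHomeo

theorem fullGroup_odometerAction_le (e : ℕ ≃ FreeGroup (Fin 2)) :
    fullGroup odometerAction ≤ fullGroup (freeThreeAction e) := by
  intro g hg x
  obtain ⟨k, hk⟩ := hg x
  exact ⟨FreeGroup.of 2 ^ k.toAdd, by rw [freeThreeAction_int]; exact hk⟩

/-- The Bernoulli shift is essentially free. -/
theorem bernoulliShift_ae_ne (e : ℕ ≃ FreeGroup (Fin 2)) {γ : FreeGroup (Fin 2)} (hγ : γ ≠ 1) :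
    ∀ᵐ x ∂bernoulliHalf, bernoulliShift e γ x ≠ x := by
  -- A fixed point of $\gamma$ is constant along the powers of $\gamma$, and these are infinitely
  -- many because $F_2$ is torsion-free.
  set s : Set ℕ := Set.range fun k : ℕ => e.symm (γ ^ k) with hs
  have hinf : s.Infinite := by
    refine Set.infinite_range_of_injective (e.symm.injective.comp ?_)
    exact injective_pow_iff_not_isOfFinOrder.2 (not_isOfFinOrder_of_isMulTorsionFree hγ)
  have hsub : {x | bernoulliShift e γ x = x} ⊆
      ⋃ b : Bool, {x : BinSeq | ∀ i ∈ s, x i = b} := by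
    intro x hx
    refine Set.mem_iUnion.2 ⟨x (e.symm 1), ?_⟩
    rintro _ ⟨k, rfl⟩
    induction k with
    | zero => simp
    | succ k ih =>
      rw [← ih]
      have h : x (e.symm (γ⁻¹ * e (e.symm (γ ^ (k + 1))))) = x (e.symm (γ ^ (k + 1))) :=
        congrFun hx _
      simpa [pow_succ'] using h.symm
  simp only [ae_iff, not_not]
  refine measure_mono_null hsub (measure_iUnion_null fun b => ?_)
  exact bernoulliHalf_eqOn_infinite hinf fun _ => b

theorem not_orbitEquivalent_odometer_freeThree (e : ℕ ≃ FreeGroup (Fin 2)) :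
    ¬ OrbitEquivalent (orbitRelation odometerAction) (orbitRelation (freeThreeAction e)) := by
  rintro ⟨g, hg⟩
  let _ : MulAction (FreeGroup (Fin 2)) BinSeq :=
    { smul γ x := bernoulliShift e γ x
      one_smul x := by
        change bernoulliShift e 1 x = x
        rw [map_one]
        rfl
      mul_smul γ δ x := by
        change bernoulliShift e (γ * δ) x = bernoulliShift e γ (bernoulliShift e δ x)
        rw [map_mul]
        rfl }
  have : MeasurableConstSMul (FreeGroup (Fin 2)) BinSeq :=
    ⟨fun γ => (bernoulliShift e γ).continuous.measurable⟩
  have : SMulInvariantMeasure (FreeGroup (Fin 2)) BinSeq bernoulliHalf :=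
    ⟨fun γ s hs => (mem_measurePreservingHomeo.1
      (bernoulliShift_mem_measurePreservingHomeo e γ)).measure_preimage hs.nullMeasurableSet⟩
  -- The finite relations are transported by $g$, which need not be known to preserve $\mu$.
  refine FreeGroup.not_hyperfinite bernoulliHalf (fun γ hγ => bernoulliShift_ae_ne e hγ)
    (fun n => (agreeFrom n).comap g.symm) (fun m n hmn x y h => agreeFrom_mono hmn h)
    (fun n γ => ?_) (fun n x => ?_) (fun γ => ?_)
  · have : {x : BinSeq | (agreeFrom n).comap g.symm (γ • x) x} =
        ⋂ i ≥ n, {x : BinSeq | g.symm (bernoulliShift e γ x) i = g.symm x i} := by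
      ext x
      simp only [Set.mem_iInter]
      rfl
    rw [this]
    refine (isClosed_biInter fun i _ => isClosed_eq ?_ ?_).measurableSet
    · exact (continuous_apply i).comp (g.symm.continuous.comp (bernoulliShift e γ).continuous)
    · exact (continuous_apply i).comp g.symm.continuous
  · exact (agreeFrom_finite n (g.symm x)).preimage g.symm.injective.injOn
  -- The exceptional orbit is countable, so its image under any bijection is null for the atomless
  -- $\mu$.
  · have hnull : bernoulliHalf (g '' {x | orbitRelation odometerAction (fun _ => true) x}) = 0 :=
      ((Set.countable_range fun k => odometerAction k fun _ => true).image g).measure_zero _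
    filter_upwards [measure_eq_zero_iff_ae_notMem.1 hnull] with x hx
    refine exists_agreeFrom_odometerAction (fun h => hx ⟨g.symm x, h, by simp⟩) ?_
    rw [hg, g.apply_symm_apply, g.apply_symm_apply]
    exact ⟨_, by rw [freeThreeAction_freeTwo]; rfl⟩

/-! ### Density -/

/-- The first `n` digits of `x`. -/
def firstDigits (n : ℕ) (x : BinSeq) : Fin n → Bool := fun i => x i

/-- The sequence obtained from a finite word by appending zeros. -/
def padZeros {n : ℕ} (s : Fin n → Bool) : BinSeq := fun i => if h : i < n then s ⟨i, h⟩ else false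

theorem firstDigits_padZeros {n : ℕ} (s : Fin n → Bool) : firstDigits n (padZeros s) = s := by
  funext i
  simp [firstDigits, padZeros]

theorem continuous_firstDigits (n : ℕ) : Continuous (firstDigits n) :=
  continuous_pi fun _ => continuous_apply _

theorem firstDigits_eq_iff {n : ℕ} {x y : BinSeq} :
    firstDigits n x = firstDigits n y ↔ ∀ i < n, x i = y i :=
  ⟨fun h i hi => congrFun h ⟨i, hi⟩, fun h => funext fun i => h i i.2⟩

/-- By compactness finitely many cylinders cover $U$, and their maximal length serves as $n$. -/
theorem IsClopen.exists_firstDigits {U : Set BinSeq} (hU : IsClopen U) :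
    ∃ n, ∀ m ≥ n, ∀ x y, firstDigits m x = firstDigits m y → (x ∈ U ↔ y ∈ U) := by
  have hcyl : ∀ x ∈ U, ∃ n, PiNat.cylinder x n ⊆ U := by
    intro x hx
    obtain ⟨_, ⟨z, n, rfl⟩, hxz, hzU⟩ := (PiNat.isTopologicalBasis_cylinders
      fun _ : ℕ => Bool).exists_subset_of_mem_open hx hU.isOpen
    exact ⟨n, by rwa [PiNat.mem_cylinder_iff_eq.1 hxz]⟩
  choose! N hN using hcyl
  obtain ⟨t, htU, ht⟩ := hU.isClosed.isCompact.elim_nhds_subcover (fun x => PiNat.cylinder x (N x))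
    fun x _ => (isClopen_cylinder_binSeq x (N x)).isOpen.mem_nhds (PiNat.self_mem_cylinder x _)
  refine ⟨t.sup N, fun m hm => ?_⟩
  have key : ∀ x y, firstDigits m x = firstDigits m y → x ∈ U → y ∈ U := by
    intro x y hxy hx
    obtain ⟨z, hz, hxz⟩ := Set.mem_iUnion₂.1 (ht hx)
    refine hN z (htU z hz) fun i hi => ?_
    rw [← firstDigits_eq_iff.1 hxy i (hi.trans_le ((Finset.le_sup hz).trans hm))]
    exact hxz i hi
  exact fun x y h => ⟨key x y h, key y x h.symm⟩

theorem bernoulliHalf_firstDigits_preimage {n : ℕ} (F : Set (Fin n → Bool)) :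
    bernoulliHalf (firstDigits n ⁻¹' F) = F.ncard * 2⁻¹ ^ n := by
  classical
  have h : firstDigits n ⁻¹' F = ⋃ s ∈ F.toFinset, firstDigits n ⁻¹' {s} := by
    ext x
    simp
  have hs : ∀ s : Fin n → Bool, bernoulliHalf (firstDigits n ⁻¹' {s}) = 2⁻¹ ^ n := by
    intro s
    rw [← bernoulliHalf_cylinder (padZeros s) n]
    congr 1
    ext x
    rw [PiNat.mem_cylinder_iff, ← firstDigits_eq_iff, firstDigits_padZeros]
    rfl
  rw [h, measure_biUnion_finset (fun s _ t _ hst => Disjoint.preimage _ (by simpa using hst))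
    fun s _ => (continuous_firstDigits n).measurable (measurableSet_singleton s)]
  simp only [hs, Finset.sum_const, nsmul_eq_mul, Set.ncard_eq_toFinset_card']

/-- The homeomorphism that permutes the words formed by the first `n` digits. -/
def permuteDigits {n : ℕ} (σ : Equiv.Perm (Fin n → Bool)) : BinSeq ≃ₜ BinSeq where
  toFun x i := if h : i < n then σ (firstDigits n x) ⟨i, h⟩ else x i
  invFun x i := if h : i < n then σ.symm (firstDigits n x) ⟨i, h⟩ else x i
  left_inv x := by
    have : firstDigits n (fun i => if h : i < n then σ (firstDigits n x) ⟨i, h⟩ else x i) =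
        σ (firstDigits n x) := by
      funext i
      simp [firstDigits]
    funext i
    simp only [this, Equiv.symm_apply_apply]
    split_ifs <;> rfl
  right_inv x := by
    have : firstDigits n (fun i => if h : i < n then σ.symm (firstDigits n x) ⟨i, h⟩ else x i) =
        σ.symm (firstDigits n x) := by
      funext i
      simp [firstDigits]
    funext i
    simp only [this, Equiv.apply_symm_apply]
    split_ifs <;> rfl
  continuous_toFun := continuous_pi fun i => by
    by_cases h : i < n
    · simp only [h, dite_true]
      exact (continuous_of_discreteTopology (f := fun s => σ s ⟨i, h⟩)).comp
        (continuous_firstDigits n)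
    · simp only [h, dite_false]
      exact continuous_apply i
  continuous_invFun := continuous_pi fun i => by
    by_cases h : i < n
    · simp only [h, dite_true]
      exact (continuous_of_discreteTopology (f := fun s => σ.symm s ⟨i, h⟩)).comp
        (continuous_firstDigits n)
    · simp only [h, dite_false]
      exact continuous_apply i

theorem firstDigits_permuteDigits {n : ℕ} (σ : Equiv.Perm (Fin n → Bool)) (x : BinSeq) :
    firstDigits n (permuteDigits σ x) = σ (firstDigits n x) := by
  funext i
  simp [firstDigits, permuteDigits]

theorem permuteDigits_mem_fullGroup {n : ℕ} (σ : Equiv.Perm (Fin n → Bool)) :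
    permuteDigits σ ∈ fullGroup odometerAction := by
  intro x
  obtain ⟨k, hk⟩ := orbitRelation_odometer_of_agreeFrom (n := n) (x := x) (y := permuteDigits σ x)
    fun i hi => by simp [permuteDigits, not_lt.2 hi]
  exact ⟨k, hk.symm⟩

/-- Bijections between corresponding fibers glue to a permutation. -/
theorem exists_perm_of_ncard_fiber_eq {α β : Type*} [Finite α] (p q : α → β)
    (h : ∀ b, {a | p a = b}.ncard = {a | q a = b}.ncard) :
    ∃ σ : Equiv.Perm α, ∀ a, q (σ a) = p a := by
  classical
  have := Fintype.ofFinite α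
  have e : ∀ b, Nonempty ({a // p a = b} ≃ {a // q a = b}) := fun b => by
    rw [← Fintype.card_eq, ← Nat.card_eq_fintype_card, ← Nat.card_eq_fintype_card]
    exact h b
  refine ⟨((Equiv.sigmaFiberEquiv p).symm.trans (Equiv.sigmaCongrRight fun b => (e b).some)).trans
    (Equiv.sigmaFiberEquiv q), fun a => ?_⟩
  exact ((e (p a)).some ⟨a, rfl⟩).2

theorem exists_mem_fullGroup_image_eq {ι : Type*} [Finite ι] (U : ι → Set BinSeq)
    (hU : ∀ i, IsClopen (U i)) {g : BinSeq ≃ₜ BinSeq}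
    (hg : g ∈ measurePreservingHomeo bernoulliHalf) :
    ∃ h ∈ fullGroup odometerAction, ∀ i, h '' U i = g '' U i := by
  have hV : ∀ i, IsClopen (g '' U i) := fun i => by
    rw [g.image_eq_preimage_symm]
    exact (hU i).preimage g.symm.continuous
  choose a ha using fun i => (hU i).exists_firstDigits
  choose b hb using fun i => (hV i).exists_firstDigits
  obtain ⟨A, hA⟩ := (Set.finite_range a).bddAbove
  obtain ⟨B, hB⟩ := (Set.finite_range b).bddAbove
  set n := max A B
  have hUn : ∀ i x y, firstDigits n x = firstDigits n y → (x ∈ U i ↔ y ∈ U i) := fun i =>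
    ha i n ((hA ⟨i, rfl⟩).trans (le_max_left A B))
  have hVn : ∀ i x y, firstDigits n x = firstDigits n y → (x ∈ g '' U i ↔ y ∈ g '' U i) :=
    fun i => hb i n ((hB ⟨i, rfl⟩).trans (le_max_right A B))
  -- Labelling a word by the set of all $i$ whose $U_i$ contains its cylinder handles overlapping
  -- sets simultaneously; the fibers of `p` and `q` are the cells of the two partitions.
  set p : (Fin n → Bool) → Set ι := fun s => {i | padZeros s ∈ U i} with hp
  set q : (Fin n → Bool) → Set ι := fun s => {i | padZeros s ∈ g '' U i} with hq
  have hpU : ∀ x i, i ∈ p (firstDigits n x) ↔ x ∈ U i := fun x i =>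
    hUn i _ _ (firstDigits_padZeros _)
  have hqV : ∀ x i, i ∈ q (firstDigits n x) ↔ x ∈ g '' U i := fun x i =>
    hVn i _ _ (firstDigits_padZeros _)
  obtain ⟨σ, hσ⟩ := exists_perm_of_ncard_fiber_eq p q fun c => by
    have himage : g '' (firstDigits n ⁻¹' {s | p s = c}) = firstDigits n ⁻¹' {s | q s = c} := by
      rw [g.image_eq_preimage_symm]
      ext x
      simp only [Set.mem_preimage, Set.mem_ofPred_eq, Set.ext_iff, hpU, hqV]
      refine forall_congr' fun i => ?_
      rw [g.image_eq_preimage_symm]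
      rfl
    have h := measure_image_of_mem_measurePreservingHomeo hg (firstDigits n ⁻¹' {s | p s = c})
    -- All cylinders of length $n$ have measure $2^{-n}$, so equal measure means equally many words.
    rw [himage, bernoulliHalf_firstDigits_preimage, bernoulliHalf_firstDigits_preimage,
      ENNReal.mul_left_inj (by simp) (by simp)] at h
    exact_mod_cast h.symm
  refine ⟨permuteDigits σ, permuteDigits_mem_fullGroup σ, fun i => ?_⟩
  have hpre : U i = permuteDigits σ ⁻¹' (g '' U i) := by
    ext x
    rw [Set.mem_preimage, ← hqV, firstDigits_permuteDigits, hσ, hpU]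
  conv_lhs => rw [hpre]
  exact Set.image_preimage_eq _ (permuteDigits σ).surjective

theorem measurePreservingHomeo_subset_closure :
    (measurePreservingHomeo bernoulliHalf : Set (BinSeq ≃ₜ BinSeq)) ⊆
      closure (fullGroup odometerAction : Set (BinSeq ≃ₜ BinSeq)) := by
  intro g hg
  -- A basic neighbourhood of $g$ involves finitely many clopen $U$, with $V = g(U)$, so matching
  -- $g$ on these sets is enough.
  rw [(TopologicalSpace.isTopologicalBasis_of_subbasis rfl).mem_closure_iff]
  rintro _ ⟨f, ⟨hf, hfS⟩, rfl⟩ hgf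
  have : Finite f := hf
  choose U V hU hV hUV using fun s : f => hfS s.2
  obtain ⟨h, hh, himage⟩ := exists_mem_fullGroup_image_eq U hU hg
  refine ⟨h, fun s hs => ?_, hh⟩
  have hgs : g ∈ s := hgf s hs
  have hsUV : s = {g : BinSeq ≃ₜ BinSeq | g '' U ⟨s, hs⟩ = V ⟨s, hs⟩} := hUV ⟨s, hs⟩
  rw [hsUV] at hgs ⊢
  exact (himage ⟨s, hs⟩).trans hgs

theorem mainTheorem8 (e : ℕ ≃ FreeGroup (Fin 2)) :
    closure (fullGroup odometerAction : Set (BinSeq ≃ₜ BinSeq)) =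
        {g : BinSeq ≃ₜ BinSeq | MeasurePreserving g bernoulliHalf bernoulliHalf} ∧
      closure (fullGroup (freeThreeAction e) : Set (BinSeq ≃ₜ BinSeq)) =
        {g : BinSeq ≃ₜ BinSeq | MeasurePreserving g bernoulliHalf bernoulliHalf} ∧
      ¬ OrbitEquivalent (orbitRelation odometerAction) (orbitRelation (freeThreeAction e)) := by
  have : Countable (FreeGroup (Fin 3)) := Quot.mk_surjective.countable
  refine ⟨?_, ?_, not_orbitEquivalent_odometer_freeThree e⟩
  · exact (closure_subset_measurePreservingHomeo (fullGroup_le_measurePreservingHomeo _ _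
      odometerAction_mem_measurePreservingHomeo)).antisymm measurePreservingHomeo_subset_closure
  · exact (closure_subset_measurePreservingHomeo (fullGroup_le_measurePreservingHomeo _ _
      (freeThreeAction_mem_measurePreservingHomeo e))).antisymm
      (measurePreservingHomeo_subset_closure.trans (closure_mono (fullGroup_odometerAction_le e)))
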